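/- Let $E$ be a directed graph: sets $E^0$ of vertices and $E^1_+$ of edges, of arbitrary cardinality, with origin and terminus maps $o,t:E^1_+\to E^0$. For each $e\in E^1_+$ let $\overline e$ be a formal reversed edge from $t(e)$ to $o(e)$. **The graph groupoid.** Let $G=G(E)$ be the fundamental groupoid of $E$: its elements are the finite undirected paths (in edges $e$ and $\overline e$) without backtracking, and multiplication is concatenation followed by cancellation of pairs $e\overline e$, $\overline e e$. For $u\in E^0$ let $T_u$ be the directed tree whose vertices are the $p\in G$ with $o(p)=u$, with a directed edge from $p$ to $pe$ for each $e\in E^1_+$ with $o(e)=t(p)$. For a directed tree $T$, a vertex $v$ and a finite set $F$ of directed edges with origin $v$, let $V(v)$ be the set of vertices that can be reached from $v$ by a finite directed path (possibly of length zero), and $V(v;F)=\{v\}\cup\bigcup\{V(t(e)) : e\notin F \text{ a directed edge with } o(e)=v\}$. The finite disjoint unions of sets $V(v;F)$, together with $\emptyset$, form a ring of sets $\mathcal A(T)$. Let $\widehat A(T)$ be its Stone space, i.e. the set of ultrafilters of $\mathcal A(T)$ with the topology generated by the sets $[B]=\{x : B\in x\}$, $B\in\mathcal A(T)$. A vertex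 $v$ defines the point $\{B\in\mathcal A(T) : v\in B\}$ of $\widehat A(T)$, and an infinite directed path $e_1e_2\cdots$ defines the point $\{B\in\mathcal A(T) : V(o(e_j))\subseteq B\text{ for some }j\}$. The boundary $\partial T$ is the closure in $\widehat A(T)$ of the set of points defined by infinite directed paths and by sinks (vertices that are the origin of no directed edge). Let $\partial\widetilde E=\bigsqcup_{u\in E^0}\partial T_u$, with the disjoint union topology. The groupoid $G$ acts on $\partial\widetilde E$ by left multiplication; let $G*\partial\widetilde E$ be the transformation groupoid, consisting of the pairs $(\alpha,x)$ with $x\in\partial T_{t(\alpha)}$, with source $x$ and range $\alpha x$. Let $X(E)\subseteq\partial\widetilde E$ be the set of points represented by directed paths in $E$, i.e. the points of $\partial T_u$, $u\in E^0$, that are defined by a vertex $p$ of $T_u$ which is a directed path from $u$, or by an infinite directed path in $T_u$ that starts at the vertex $u$ (the path of length zero). The graph groupoid $\mathcal G(E)$ is the restriction of $G*\partial\widetilde E$ to $X(E)$; its unit space is $X(E)$ with the subspace topology. **Essential principality.** A groupoid with topological unit space is *essentially free* if the set of units with trivial isotropy is dense in the unit space. It is *essentially principal* if its restriction to every closed invariant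 subset of its unit space is essentially free. **Cycles.** A *cycle* in $E$ is a directed path $\alpha=e_1\cdots e_n$ in $E$, $n\ge1$, with $t(e_n)=o(e_1)$ and $o(e_i)\ne o(e_j)$ for $i\neq j$. An *exit* of $\alpha$ is an edge $f\in E^1_+$ such that $o(f)=o(e_i)$ and $f\ne e_i$ for some $i$. The cycle $\alpha$ is *terminal* if it has no exit; it is *transitory* if it has an exit, but for every exit $f$ of $\alpha$ and every $j$ there is no finite directed path (possibly of length zero) in $E$ from $t(f)$ to $o(e_j)$. **Theorem.** The graph groupoid $\mathcal G(E)$ is essentially principal if and only if $E$ has no terminal cycle and no transitory cycle. -/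

import Mathlib

open CategoryTheory

universe u v w

namespace DirGraph

/-! A directed graph is a `Quiver E`: the vertices are `E`, the positively oriented edges are the
arrows `a ⟶ b` (origin `a`, terminus `b`), and the reversed edges are those of
`Quiver.Symmetrify E`. Directed paths of finite length are terms of `Quiver.Path`. -/

section Boundary

/-! ### The boundary of a directed tree

The definitions make sense for every quiver `T`; they are used for directed trees. -/

variable {T : Type u} [Quiver.{v} T]

/-- `V(v)`: the vertices reached from `v` by a directed path of finite length (possibly zero). -/
def reach (v : T) : Set T := {w | Nonempty (Quiver.Path v w)}

/-- `V(v;F) = {v} ∪ ⋃_{e ∈ Δ₁(v) \ F} V(t(e))`, for a finite set `F` of edges with origin `v`. -/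
def reachAvoid (v : T) (F : Finset (Quiver.Star v)) : Set T :=
  {w | w = v ∨ ∃ e : Quiver.Star v, e ∉ F ∧ w ∈ reach e.1}

variable (T) in
/-- The family consisting of the empty set and all sets `V(v;F)`. -/
def basicSets : Set (Set T) :=
  {B | B = ∅ ∨ ∃ (v : T) (F : Finset (Quiver.Star v)), B = reachAvoid v F}

variable (T) in
/-- The family of finite disjoint unions of sets `V(v;F)`; for a directed tree, this is
a Boolean ring of sets. -/
def setRing : Set (Set T) :=
  {B | ∃ S : Set (Set T), S.Finite ∧ S ⊆ basicSets T ∧ S.PairwiseDisjoint id ∧ B = ⋃₀ S}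

/-- Proper filters in the ring of sets `setRing T` (which need not have a largest element). -/
structure IsRingFilter (U : Set (Set T)) : Prop where
  subset : U ⊆ setRing T
  nonempty : U.Nonempty
  empty_notMem : ∅ ∉ U
  inter_mem : ∀ B ∈ U, ∀ C ∈ U, B ∩ C ∈ U
  mem_of_superset : ∀ B ∈ U, ∀ C ∈ setRing T, B ⊆ C → C ∈ U

variable (T) in
/-- The ultrafilters of the ring of sets `setRing T`: its Stone space, which is the spectrum of
the commutative C*-algebra generated by the characteristic functions of members of `setRing T`. -/
@[ext]
structure Spec where
  sets : Set (Set T)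
  isFilter : IsRingFilter sets
  maximal : ∀ U : Set (Set T), IsRingFilter U → sets ⊆ U → U = sets

/-- The Stone topology: a basis consists of the sets `[B] = {x | B ∈ x}`, `B ∈ setRing T`. -/
instance : TopologicalSpace (Spec T) :=
  TopologicalSpace.generateFrom {O | ∃ B ∈ setRing T, O = {x : Spec T | B ∈ x.sets}}

variable (T) in
/-- Infinite directed paths: the `n`-th edge goes from `vert n` to `vert (n + 1)`. -/
structure InfPath where
  vert : ℕ → T
  edge : ∀ n, vert n ⟶ vert (n + 1)

/-- The fixed ultrafilter given by a vertex. -/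
def vertexFilter (v : T) : Set (Set T) := {B | B ∈ setRing T ∧ v ∈ B}

/-- The ultrafilter given by an infinite directed path; it depends only on the tail equivalence
class of the path. -/
def pathFilter (p : InfPath T) : Set (Set T) :=
  {B | B ∈ setRing T ∧ ∃ j, reach (p.vert j) ⊆ B}

variable (T) in
/-- The boundary `∂T`: the closure of the set of points given by infinite directed paths and by
finite directed paths ending at a sink. -/
def boundary : Set (Spec T) :=
  closure {x | (∃ p : InfPath T, x.sets = pathFilter p) ∨
    ∃ v : T, IsEmpty (Quiver.Star v) ∧ x.sets = vertexFilter v}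

end Boundary

section Cover

/-! ### The universal cover and the graph groupoid -/

/-- The arrows `α : o(α) ⟶ t(α)` of the fundamental groupoid `G(E)`: undirected paths in `E`
modulo cancellation of edges against their reversals, multiplied by concatenation. Each class
contains exactly one path without backtracking. -/
abbrev Arrow {E : Type u} [Quiver.{v} E] (a b : E) :=
  (Quiver.FreeGroupoid.of E).obj a ⟶ (Quiver.FreeGroupoid.of E).obj b

/-- The directed edge `e`, as an element of the fundamental groupoid. -/
abbrev edgeArrow {E : Type u} [Quiver.{v} E] {a b : E} (e : a ⟶ b) : Arrow a b :=
  (Quiver.FreeGroupoid.of E).map e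

/-- The component over `o` of the universal cover of `E`: its vertices are the elements of the
fundamental groupoid with origin `o`. -/
@[ext]
structure CoverTree {E : Type u} [Quiver.{v} E] (o : E) where
  terminus : E
  path : Arrow o terminus

/-- There is a directed edge from `p` to `q` for each directed edge `e` of `E` with `q = pe`. -/
instance {E : Type u} [Quiver.{v} E] (o : E) : Quiver.{v} (CoverTree o) where
  Hom p q := {e : p.terminus ⟶ q.terminus // q.path = p.path ≫ edgeArrow e}

/-- The vertex of the universal cover given by the path of length zero at `o`. -/
def root {E : Type u} [Quiver.{v} E] (o : E) : CoverTree o := ⟨o, 𝟙 _⟩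

/-- The action `p ↦ αp` of the fundamental groupoid on the universal cover. -/
abbrev leftMul {E : Type u} [Quiver.{v} E] {a b : E} (α : Arrow a b) (p : CoverTree b) :
    CoverTree a :=
  ⟨p.terminus, α ≫ p.path⟩

/-- The boundary of the universal cover: the disjoint union of the boundaries of the components,
with the disjoint union topology. -/
abbrev CoverBoundary (E : Type u) [Quiver.{v} E] := Σ o : E, boundary (CoverTree o)

/-- `y = αx`, for points `x`, `y` of the boundary of the universal cover lying over `t(α)` and
`o(α)`: a set `B` belongs to the ultrafilter `αx` if and only if `α⁻¹B` belongs to `x`. -/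
def IsTranslate {E : Type u} [Quiver.{v} E] (x y : CoverBoundary E) (α : Arrow y.1 x.1) : Prop :=
  ∀ B : Set (CoverTree y.1), B ∈ y.2.1.sets ↔ leftMul α ⁻¹' B ∈ x.2.1.sets

/-- The transformation groupoid of the action of the fundamental groupoid on the boundary of the
universal cover. The elements with source `x` and range `y` are the pairs `(α,x)` with `αx = y`;
the composite of `(α,x)` followed by `(β,αx)` is `(βα,x)`. -/
instance coverGroupoid (E : Type u) [Quiver.{v} E] : Groupoid (CoverBoundary E) where
  Hom x y := {α : Arrow y.1 x.1 // IsTranslate x y α}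
  id x := ⟨𝟙 _, fun B => by
    have : leftMul (𝟙 _ : Arrow x.1 x.1) ⁻¹' B = B := by ext p; simp [leftMul]
    rw [this]⟩
  comp {x y z} f g := ⟨g.1 ≫ f.1, fun B => by
    have : leftMul (g.1 ≫ f.1) ⁻¹' B = leftMul f.1 ⁻¹' (leftMul g.1 ⁻¹' B) := by
      ext p; simp [leftMul]
    rw [this, g.2 B, f.2]⟩
  inv {x y} f := ⟨Groupoid.inv f.1, fun B => by
    have : leftMul f.1 ⁻¹' (leftMul (Groupoid.inv f.1) ⁻¹' B) = B := by
      ext p; simp [leftMul]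
    rw [f.2, this]⟩
  id_comp f := Subtype.ext (Category.comp_id _)
  comp_id f := Subtype.ext (Category.id_comp _)
  assoc f g h := Subtype.ext (Category.assoc _ _ _).symm
  inv_comp f := Subtype.ext (Groupoid.comp_inv f.1)
  comp_inv f := Subtype.ext (Groupoid.inv_comp f.1)

end Cover

section Groupoids

/-! ### Topological properties of groupoids

Objects are units. The properties below involve the topology of the unit space only. -/

/-- The restriction of a groupoid to a set `K` of units. -/
@[reducible]
def restriction {X : Type u} [Groupoid.{v} X] (K : Set X) : Groupoid.{v} K where
  Hom a b := a.1 ⟶ b.1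
  id a := 𝟙 a.1
  comp f g := CategoryStruct.comp (obj := X) f g
  inv f := Groupoid.inv (obj := X) f
  id_comp f := Category.id_comp (obj := X) f
  comp_id f := Category.comp_id (obj := X) f
  assoc f g h := Category.assoc (obj := X) f g h
  inv_comp f := Groupoid.inv_comp (obj := X) f
  comp_inv f := Groupoid.comp_inv (obj := X) f

/-- The units with trivial isotropy are dense. -/
def EssentiallyFree (X : Type u) [TopologicalSpace X] [Groupoid.{v} X] : Prop :=
  Dense {x : X | ∀ g : x ⟶ x, g = 𝟙 x}

/-- A set of units is invariant if it contains the range of every element whose source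
it contains. -/
def IsInvariant {X : Type u} [Groupoid.{v} X] (K : Set X) : Prop :=
  ∀ ⦃x y : X⦄, (x ⟶ y) → x ∈ K → y ∈ K

/-- The restriction to each closed invariant set of units is essentially free. -/
def EssentiallyPrincipal (X : Type u) [TopologicalSpace X] [Groupoid.{v} X] : Prop :=
  ∀ K : Set X, IsClosed K → IsInvariant K → @EssentiallyFree K _ (restriction K)

end Groupoids

section GraphGroupoid

/-- The set of all points of the boundary of the universal cover that are represented by directed
paths in `E`, that is, by directed paths, finite or infinite, that start at a root. -/
def directedPoints (E : Type u) [Quiver.{v} E] : Set (CoverBoundary E) :=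
  {x | (∃ p ∈ reach (root x.1), x.2.1.sets = vertexFilter p) ∨
    ∃ p : InfPath (CoverTree x.1), p.vert 0 = root x.1 ∧ x.2.1.sets = pathFilter p}

/-- The unit space of the graph groupoid, with the subspace topology. -/
abbrev UnitSpace (E : Type u) [Quiver.{v} E] := ↥(directedPoints E)

/-- The graph groupoid `𝒢(E)`: the restriction of the transformation groupoid to the points
represented by directed paths. -/
@[reducible]
def graphGroupoid (E : Type u) [Quiver.{v} E] : Groupoid (UnitSpace E) :=
  restriction (directedPoints E)

end GraphGroupoid

section Cycles

/-- A cycle `e₁⋯eₙ`, `n = len + 1 ≥ 1`, indexed by `Fin n` with cyclic addition: the terminus of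
each edge is the origin of the next one, the last edge ends where the first one begins, and the
origins of the edges are distinct. -/
structure DirCycle (E : Type u) [Quiver.{v} E] where
  len : ℕ
  edge : Fin (len + 1) → Quiver.Total E
  chain : ∀ i, (edge i).right = (edge (i + 1)).left
  origins_injective : Function.Injective fun i => (edge i).left

namespace DirCycle

variable {E : Type u} [Quiver.{v} E] (c : DirCycle E)

/-- An exit is an edge `f ≠ eᵢ` with the same origin as `eᵢ`, for some `i`. -/
def IsExit (f : Quiver.Total E) : Prop := ∃ i, f.left = (c.edge i).left ∧ f ≠ c.edge i

/-- A cycle without exits. -/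
def IsTerminal : Prop := ∀ f, ¬ c.IsExit f

/-- A cycle that has an exit, but such that no exit leads back to the cycle. -/
def IsTransitory : Prop :=
  ¬ c.IsTerminal ∧ ∀ f, c.IsExit f → ∀ j, (c.edge j).left ∉ reach f.right

end DirCycle

end Cycles

end DirGraph

/-!
Whether the groupoid is essentially principal is decided by the infinite paths. An arrow of the
fundamental groupoid that fixes the point of a vertex `p` of the universal cover fixes `p`, hence is
trivial (`eq_id_of_vertexFilter`). An arrow that fixes the point of an infinite path `x` shifts the
vertices of `x` (`eq_id_or_eventuallyPeriodic`), so nontrivial isotropy forces the edges of `x` to be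
eventually periodic.

If there is no terminal and no transitory cycle, then some vertex on any closed path has two
edges from which one can return (`exists_returning_edge`). Hence there are infinite paths that are
not eventually periodic and from which the closed path always stays within reach
(`exists_not_eventuallyPeriodic`). Inserted after a long initial segment of an eventually periodic
path `x`, such a path gives a point near `x` with trivial isotropy. It is a limit of points in the
orbit of `x`, so it lies in each closed invariant set that contains `x` (`dense_trivialIsotropy`).

Conversely, for a vertex `w` on a terminal or transitory cycle, the points all of whose members
contain some `V(q)` with `q` over `w` form a closed invariant set (`recurrentSet`). As no exit leads
back to the cycle, the only point of this set over `w` is the path that runs around the cycle for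
ever. It is isolated and has nontrivial isotropy (`not_dense_trivialIsotropy`).

Both directions need that an infinite path defines an ultrafilter of the ring of sets (`pathSpec`),
which rests on the order structure of the universal cover: vertices between two given ones form a
chain (`reach_of_deg_le`), and two vertices with a common descendant have a least one
(`exists_join`). Both facts are derived from reduced words by mapping the fundamental groupoid to
the free group on the edges of `E`.
-/

namespace DirGraph

variable {E : Type u} [Quiver.{v} E]

/-! ### Labels of arrows in the free group on the edges -/

/-- A directed edge of `E` as an element of the free group on all edges, viewed as an arrow of a
one-object groupoid. -/
def edgeLabel (E : Type u) [Quiver.{v} E] :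
    E ⥤q SingleObj (FreeGroup (Quiver.Total E)) where
  obj _ := SingleObj.star _
  map {a b} e := FreeGroup.of (⟨a, b, e⟩ : Quiver.Total E)

/-- The class of an arrow of the fundamental groupoid in the free group on the edges of `E`.
Composition in `SingleObj` is reversed multiplication, so that the last edge of a path becomes the
first factor. -/
def label {a b : E} (α : Arrow a b) : FreeGroup (Quiver.Total E) :=
  (Quiver.FreeGroupoid.lift (edgeLabel E)).map α

theorem label_comp {a b c : E} (α : Arrow a b) (β : Arrow b c) :
    label (α ≫ β) = label β * label α :=
  Functor.map_comp _ _ _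

theorem label_edgeArrow {a b : E} (e : a ⟶ b) :
    label (edgeArrow e) = FreeGroup.of (⟨a, b, e⟩ : Quiver.Total E) := by
  have h := Prefunctor.congr_hom (Quiver.FreeGroupoid.lift_spec (edgeLabel E)) e
  exact h

theorem edgeArrow_injective {a b : E} {e f : a ⟶ b} (h : edgeArrow e = edgeArrow f) : e = f := by
  have h' := congrArg label h
  rw [label_edgeArrow, label_edgeArrow] at h'
  have := FreeGroup.of_injective h'
  simpa using this

/-- The degree of an arrow of the fundamental groupoid: the number of positively oriented edges
minus the number of reversed ones. -/
def arrowDegree {a b : E} (α : Arrow a b) : ℤ :=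
  Multiplicative.toAdd
    (FreeGroup.lift (fun _ : Quiver.Total E => Multiplicative.ofAdd (1 : ℤ)) (label α))

theorem arrowDegree_comp {a b c : E} (α : Arrow a b) (β : Arrow b c) :
    arrowDegree (α ≫ β) = arrowDegree α + arrowDegree β := by
  simp [arrowDegree, label_comp, add_comm]

theorem arrowDegree_edgeArrow {a b : E} (e : a ⟶ b) : arrowDegree (edgeArrow e) = 1 := by
  simp [arrowDegree, label_edgeArrow]

/-! ### The order structure of the universal cover -/

section CoverOrder

variable {o : E}

/-- The degree of a vertex of the universal cover; it grows by one along each directed edge. -/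
def deg (p : CoverTree o) : ℤ := arrowDegree p.path

theorem deg_edge {p q : CoverTree o} (e : p ⟶ q) : deg q = deg p + 1 := by
  rw [deg, e.2, arrowDegree_comp, arrowDegree_edgeArrow, deg]

theorem deg_path {p q : CoverTree o} (P : Quiver.Path p q) : deg q = deg p + P.length := by
  induction P with
  | nil => simp
  | cons P e ih => rw [deg_edge e, ih, Quiver.Path.length_cons]; push_cast; ring

/-- The edge of `E` that labels an edge of the universal cover. -/
def edgeTotal {p q : CoverTree o} (e : p ⟶ q) : Quiver.Total E := ⟨p.terminus, q.terminus, e.1⟩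

/-- The labels of the edges of a path in the universal cover, the last edge first. -/
def pathLabels {p : CoverTree o} : ∀ {q : CoverTree o}, Quiver.Path p q → List (Quiver.Total E)
  | _, .nil => []
  | _, .cons P e => edgeTotal e :: pathLabels P

theorem label_path {p q : CoverTree o} (P : Quiver.Path p q) :
    label q.path = FreeGroup.mk ((pathLabels P).map fun t => (t, true)) * label p.path := by
  induction P with
  | nil => simp [pathLabels, ← FreeGroup.one_eq_mk]
  | cons P e ih =>
    rw [e.2, label_comp, ih, label_edgeArrow, ← mul_assoc]
    rfl

/-- An edge of the universal cover is determined by its origin and its label. -/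
theorem edge_target_unique {p q q' : CoverTree o} (e : p ⟶ q) (e' : p ⟶ q')
    (h : edgeTotal e = edgeTotal e') : q = q' := by
  obtain ⟨t, x⟩ := q
  obtain ⟨t', x'⟩ := q'
  obtain ⟨e, he⟩ := e
  obtain ⟨e', he'⟩ := e'
  simp only [edgeTotal, Quiver.Total.mk.injEq, true_and] at h
  obtain ⟨rfl, h⟩ := h
  obtain rfl := eq_of_heq h
  simp only at he he'
  rw [he, he']

/-- An edge of the universal cover is determined by its terminus and its label. -/
theorem edge_source_unique {p p' q : CoverTree o} (e : p ⟶ q) (e' : p' ⟶ q)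
    (h : edgeTotal e = edgeTotal e') : p = p' := by
  obtain ⟨t, x⟩ := p
  obtain ⟨t', x'⟩ := p'
  obtain ⟨e, he⟩ := e
  obtain ⟨e', he'⟩ := e'
  simp only [edgeTotal, Quiver.Total.mk.injEq, true_and] at h
  obtain ⟨rfl, h⟩ := h
  obtain rfl := eq_of_heq h
  simp only at he he'
  rw [he, cancel_mono] at he'
  rw [he']

theorem edge_subsingleton {p q : CoverTree o} (e e' : p ⟶ q) : e = e' :=
  Subtype.ext (edgeArrow_injective ((cancel_epi p.path).1 (e.2.symm.trans e'.2)))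

theorem path_target_unique {p q q' : CoverTree o} (P : Quiver.Path p q) (P' : Quiver.Path p q')
    (h : pathLabels P = pathLabels P') : q = q' := by
  induction P generalizing q' with
  | nil =>
    cases P' with
    | nil => rfl
    | cons P' e' => simp [pathLabels] at h
  | cons P e ih =>
    cases P' with
    | nil => simp [pathLabels] at h
    | cons P' e' =>
      simp only [pathLabels, List.cons.injEq] at h
      obtain rfl := ih P' h.2
      exact edge_target_unique e e' h.1

/-- A word in the generators alone, or in their inverses alone, is reduced. -/
theorem isReduced_of_sign {α : Type*} (l : List α) (b : Bool) :
    FreeGroup.IsReduced (l.map fun t => (t, b)) := by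
  rw [FreeGroup.IsReduced, List.isChain_map]
  exact (List.pairwise_of_forall fun _ _ _ => rfl).isChain

theorem mk_pos_injective {α : Type*} {l l' : List α}
    (h : FreeGroup.mk (l.map fun t => (t, true)) = FreeGroup.mk (l'.map fun t => (t, true))) :
    l = l' := by
  classical
  have h2 := congrArg FreeGroup.toWord h
  rw [FreeGroup.toWord_mk, FreeGroup.toWord_mk, (isReduced_of_sign l true).reduce_eq,
    (isReduced_of_sign l' true).reduce_eq] at h2
  exact List.map_injective_iff.2 (fun a b h => (Prod.mk.inj h).1) h2

theorem pathLabels_unique {p q : CoverTree o} (P P' : Quiver.Path p q) :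
    pathLabels P = pathLabels P' :=
  mk_pos_injective (mul_right_cancel ((label_path P).symm.trans (label_path P')))

end CoverOrder

section Reach

theorem mem_reach_self {T : Type*} [Quiver T] (p : T) : p ∈ reach p := ⟨.nil⟩

theorem reach_trans {T : Type*} [Quiver T] {p q r : T} (h : q ∈ reach p) (h' : r ∈ reach q) :
    r ∈ reach p := by
  obtain ⟨P⟩ := h
  obtain ⟨Q⟩ := h'
  exact ⟨P.comp Q⟩

theorem edge_mem_reach {T : Type*} [Quiver T] {p q : T} (e : p ⟶ q) : q ∈ reach p := ⟨e.toPath⟩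

theorem reach_subset {T : Type*} [Quiver T] {p q : T} (h : q ∈ reach p) : reach q ⊆ reach p :=
  fun _ hr => reach_trans h hr

theorem exists_star_of_reach {T : Type*} [Quiver T] {p q : T} (h : q ∈ reach p) (hne : q ≠ p) :
    ∃ e : Quiver.Star p, q ∈ reach e.1 := by
  obtain ⟨P⟩ := h
  induction P with
  | nil => exact absurd rfl hne
  | @cons a b P f ih =>
    by_cases ha : a = p
    · subst ha
      exact ⟨⟨b, f⟩, mem_reach_self b⟩
    · obtain ⟨e, he⟩ := ih ha
      exact ⟨e, reach_trans he (edge_mem_reach f)⟩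

end Reach

section CoverOrder

variable {o : E}

theorem deg_le_of_reach {p q : CoverTree o} (h : q ∈ reach p) : deg p ≤ deg q := by
  obtain ⟨P⟩ := h
  have := deg_path P
  omega

theorem eq_of_reach_of_deg {p q : CoverTree o} (h : q ∈ reach p) (hd : deg q ≤ deg p) :
    p = q := by
  obtain ⟨P⟩ := h
  have := deg_path P
  exact Quiver.Path.eq_of_length_zero P (by omega)

/-- The vertices between two given vertices form a chain. -/
theorem reach_of_deg_le {p a b z : CoverTree o} (ha : a ∈ reach p) (haz : z ∈ reach a)
    (hb : b ∈ reach p) (hbz : z ∈ reach b) (hd : deg a ≤ deg b) : b ∈ reach a := by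
  obtain ⟨P⟩ := ha
  obtain ⟨Q⟩ := hb
  obtain ⟨R⟩ := haz
  obtain ⟨S⟩ := hbz
  induction S with
  | nil => exact ⟨R⟩
  | cons S e ih =>
    cases R with
    | nil =>
      have h1 := deg_path S
      have h2 := deg_edge e
      omega
    | cons R f =>
      have h := pathLabels_unique ((P.comp R).cons f) ((Q.comp S).cons e)
      simp only [pathLabels, List.cons.injEq] at h
      obtain rfl := edge_source_unique f e h.1
      exact ih R

/-- Vertices of equal degree between two given vertices coincide. -/
theorem eq_of_deg_eq {p a b z : CoverTree o} (ha : a ∈ reach p) (haz : z ∈ reach a)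
    (hb : b ∈ reach p) (hbz : z ∈ reach b) (hd : deg a = deg b) : a = b :=
  eq_of_reach_of_deg (reach_of_deg_le ha haz hb hbz hd.le) hd.ge

/-- The word `k⁻¹ l` in the free group. If `k` and `l` are the labels of paths from `p` and `q` to
a common terminus, this is the label of the arrow `q⁻¹ p`, hence independent of the terminus. -/
def joinWord (k l : List (Quiver.Total E)) : List (Quiver.Total E × Bool) :=
  (k.map fun t => (t, false)).reverse ++ l.map fun t => (t, true)

theorem mk_joinWord (k l : List (Quiver.Total E)) :
    FreeGroup.mk (joinWord k l) =
      (FreeGroup.mk (k.map fun t => (t, true)))⁻¹ * FreeGroup.mk (l.map fun t => (t, true)) := by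
  rw [FreeGroup.inv_mk, FreeGroup.mul_mk, joinWord, FreeGroup.invRev, List.map_map]
  rfl

theorem joinWord_injective {k l k' l' : List (Quiver.Total E)}
    (h : joinWord k l = joinWord k' l') : k = k' := by
  have h' := congrArg (List.map Prod.fst ∘ List.filter fun x => !x.2) h
  simpa [joinWord, List.filter_map, Function.comp_def] using h'

/-- Removing the common final segment of two paths with the same terminus. -/
theorem exists_reduced_join {p q z : CoverTree o} (P : Quiver.Path p z) (Q : Quiver.Path q z) :
    ∃ (m : CoverTree o) (P' : Quiver.Path p m) (Q' : Quiver.Path q m), z ∈ reach m ∧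
      FreeGroup.IsReduced (joinWord (pathLabels P') (pathLabels Q')) := by
  have neg : ∀ l : List (Quiver.Total E),
      FreeGroup.IsReduced (l.map fun t => (t, false)).reverse := by
    intro l
    rw [← List.map_reverse]
    exact isReduced_of_sign _ _
  induction P with
  | nil =>
    refine ⟨_, .nil, Q, ⟨.nil⟩, ?_⟩
    simpa [joinWord, pathLabels] using isReduced_of_sign _ true
  | @cons a z P e ih =>
    cases Q with
    | nil =>
      refine ⟨_, P.cons e, .nil, ⟨.nil⟩, ?_⟩
      simpa [joinWord, pathLabels] using neg (edgeTotal e :: pathLabels P)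
    | cons Q f =>
      by_cases hef : edgeTotal e = edgeTotal f
      · obtain rfl := edge_source_unique e f hef
        obtain ⟨m, P', Q', hm, hr⟩ := ih Q
        exact ⟨m, P', Q', reach_trans hm (edge_mem_reach e), hr⟩
      · refine ⟨_, P.cons e, Q.cons f, ⟨.nil⟩, ?_⟩
        have h1 := isReduced_of_sign (pathLabels (Q.cons f)) true
        have h2 := neg (pathLabels (P.cons e))
        rw [FreeGroup.IsReduced] at h1 h2 ⊢
        rw [joinWord, List.isChain_append]
        refine ⟨h2, h1, ?_⟩
        simp [pathLabels, hef]

/-- If two vertices of the universal cover have a common descendant, they have a least one. -/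
theorem exists_join {p q z : CoverTree o} (hp : z ∈ reach p) (hq : z ∈ reach q) :
    ∃ m, m ∈ reach p ∧ m ∈ reach q ∧ ∀ y, y ∈ reach p → y ∈ reach q → y ∈ reach m := by
  classical
  obtain ⟨P⟩ := hp
  obtain ⟨Q⟩ := hq
  obtain ⟨m, P, Q, -, hr⟩ := exists_reduced_join P Q
  refine ⟨m, ⟨P⟩, ⟨Q⟩, ?_⟩
  rintro y ⟨P₁⟩ ⟨Q₁⟩
  obtain ⟨n, P₁, Q₁, hn, hr₁⟩ := exists_reduced_join P₁ Q₁
  have key : ∀ {m : CoverTree o} (P : Quiver.Path p m) (Q : Quiver.Path q m),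
      FreeGroup.mk (joinWord (pathLabels P) (pathLabels Q)) = label p.path * (label q.path)⁻¹ := by
    intro m P Q
    rw [mk_joinWord, inv_mul_eq_iff_eq_mul, ← mul_assoc, ← label_path P, label_path Q,
      mul_inv_cancel_right]
  have h := congrArg FreeGroup.toWord ((key P Q).trans (key P₁ Q₁).symm)
  rw [FreeGroup.toWord_mk, FreeGroup.toWord_mk, hr.reduce_eq, hr₁.reduce_eq] at h
  rw [path_target_unique P P₁ (joinWord_injective h)]
  exact hn

/-- An edge of the universal cover is determined by its origin and its terminus. -/
theorem star_ext {p : CoverTree o} {e f : Quiver.Star p} (h : e.1 = f.1) : e = f := by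
  obtain ⟨q, e⟩ := e
  obtain ⟨q', f⟩ := f
  obtain rfl : q = q' := h
  rw [edge_subsingleton e f]

/-- Distinct edges with the same origin lead to disjoint sets of descendants. -/
theorem star_unique {p z : CoverTree o} {e f : Quiver.Star p} (he : z ∈ reach e.1)
    (hf : z ∈ reach f.1) : e = f :=
  star_ext (eq_of_deg_eq (edge_mem_reach e.2) he (edge_mem_reach f.2) hf
    ((deg_edge e.2).trans (deg_edge f.2).symm))

theorem not_mem_reach_star {p : CoverTree o} (e : Quiver.Star p) : p ∉ reach e.1 := by
  intro h
  have h1 := deg_le_of_reach h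
  have h2 := deg_edge e.2
  omega

end CoverOrder

/-! ### The ring of sets generated by the sets `V(v;F)` -/

section RingOfSets

variable {o : E}

theorem reachAvoid_subset_reach {T : Type*} [Quiver T] (p : T) (F : Finset (Quiver.Star p)) :
    reachAvoid p F ⊆ reach p := by
  rintro w (rfl | ⟨e, -, hw⟩)
  · exact mem_reach_self _
  · exact reach_trans (edge_mem_reach e.2) hw

theorem self_mem_reachAvoid {T : Type*} [Quiver T] (p : T) (F : Finset (Quiver.Star p)) :
    p ∈ reachAvoid p F := Or.inl rfl

theorem reachAvoid_empty {T : Type*} [Quiver T] (p : T) : reachAvoid p ∅ = reach p := by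
  refine (reachAvoid_subset_reach p ∅).antisymm fun w hw => ?_
  by_cases h : w = p
  · exact Or.inl h
  · obtain ⟨e, he⟩ := exists_star_of_reach hw h
    exact Or.inr ⟨e, Finset.notMem_empty e, he⟩

theorem reachAvoid_mem_setRing {T : Type*} [Quiver T] (p : T) (F : Finset (Quiver.Star p)) :
    reachAvoid p F ∈ setRing T := by
  refine ⟨{reachAvoid p F}, Set.finite_singleton _, ?_, Set.pairwiseDisjoint_singleton _ _, ?_⟩
  · rintro _ rfl
    exact Or.inr ⟨p, F, rfl⟩
  · simp

theorem reach_mem_setRing {T : Type*} [Quiver T] (p : T) : reach p ∈ setRing T :=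
  reachAvoid_empty p ▸ reachAvoid_mem_setRing p ∅

theorem reach_mem_basicSets {T : Type*} [Quiver T] (p : T) : reach p ∈ basicSets T :=
  Or.inr ⟨p, ∅, (reachAvoid_empty p).symm⟩

/-- Below a proper descendant `m` of `p`, the set `V(p;F)` is everything or nothing, according to
the first edge on the way from `p` to `m`. -/
theorem reach_subset_or_disjoint {p m : CoverTree o} (F : Finset (Quiver.Star p))
    (hm : m ∈ reach p) (hne : m ≠ p) :
    reach m ⊆ reachAvoid p F ∨ Disjoint (reachAvoid p F) (reach m) := by
  obtain ⟨e, he⟩ := exists_star_of_reach hm hne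
  by_cases heF : e ∈ F
  · right
    rw [Set.disjoint_left]
    rintro z (rfl | ⟨f, hf, hz⟩) hzm
    · exact not_mem_reach_star e (reach_trans he hzm)
    · exact hf (star_unique hz (reach_trans he hzm) ▸ heF)
  · exact Or.inl fun z hz => Or.inr ⟨e, heF, reach_trans he hz⟩

theorem reachAvoid_inter_reachAvoid {p : CoverTree o} (F G : Finset (Quiver.Star p)) :
    ∃ H : Finset (Quiver.Star p), reachAvoid p F ∩ reachAvoid p G = reachAvoid p H := by
  classical
  refine ⟨F ∪ G, ?_⟩
  ext z
  constructor
  · rintro ⟨rfl | ⟨e, he, hz⟩, h⟩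
    · exact Or.inl rfl
    · obtain rfl | ⟨f, hf, hz'⟩ := h
      · exact Or.inl rfl
      · obtain rfl := star_unique hz hz'
        exact Or.inr ⟨e, by simp [he, hf], hz⟩
  · rintro (rfl | ⟨e, he, hz⟩)
    · exact ⟨Or.inl rfl, Or.inl rfl⟩
    · simp only [Finset.mem_union, not_or] at he
      exact ⟨Or.inr ⟨e, he.1, hz⟩, Or.inr ⟨e, he.2, hz⟩⟩

theorem basicSets_inter {A B : Set (CoverTree o)} (hA : A ∈ basicSets (CoverTree o))
    (hB : B ∈ basicSets (CoverTree o)) : A ∩ B ∈ basicSets (CoverTree o) := by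
  obtain rfl | ⟨p, F, rfl⟩ := hA
  · simp [basicSets]
  obtain rfl | ⟨q, G, rfl⟩ := hB
  · simp [basicSets]
  obtain h | ⟨z, hzp, hzq⟩ := (reachAvoid p F ∩ reachAvoid q G).eq_empty_or_nonempty
  · exact Or.inl h
  obtain ⟨m, hmp, hmq, hm⟩ := exists_join (reachAvoid_subset_reach _ _ hzp)
    (reachAvoid_subset_reach _ _ hzq)
  have hzm : z ∈ reach m :=
    hm z (reachAvoid_subset_reach _ _ hzp) (reachAvoid_subset_reach _ _ hzq)
  have hsub : reachAvoid p F ∩ reachAvoid q G ⊆ reach m := fun y hy =>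
    hm y (reachAvoid_subset_reach _ _ hy.1) (reachAvoid_subset_reach _ _ hy.2)
  by_cases hp : m = p
  · subst hp
    by_cases hq : m = q
    · subst hq
      exact Or.inr ⟨m, reachAvoid_inter_reachAvoid F G⟩
    · obtain h | h := reach_subset_or_disjoint G hmq hq
      · rw [Set.inter_eq_left.2 ((reachAvoid_subset_reach m F).trans h)]
        exact Or.inr ⟨m, F, rfl⟩
      · exact absurd hzm (Set.disjoint_left.1 h hzq)
  · obtain h | h := reach_subset_or_disjoint F hmp hp
    swap
    · exact absurd hzm (Set.disjoint_left.1 h hzp)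
    by_cases hq : m = q
    · subst hq
      rw [Set.inter_eq_right.2 ((reachAvoid_subset_reach m G).trans h)]
      exact Or.inr ⟨m, G, rfl⟩
    · obtain h' | h' := reach_subset_or_disjoint G hmq hq
      · rw [hsub.antisymm (Set.subset_inter h h')]
        exact reach_mem_basicSets m
      · exact absurd hzm (Set.disjoint_left.1 h' hzq)

theorem setRing_inter {A B : Set (CoverTree o)} (hA : A ∈ setRing (CoverTree o))
    (hB : B ∈ setRing (CoverTree o)) : A ∩ B ∈ setRing (CoverTree o) := by
  obtain ⟨S, hSf, hSb, hSd, rfl⟩ := hA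
  obtain ⟨R, hRf, hRb, hRd, rfl⟩ := hB
  refine ⟨Set.image2 (· ∩ ·) S R, hSf.image2 _ hRf, ?_, ?_, ?_⟩
  · rintro _ ⟨s, hs, r, hr, rfl⟩
    exact basicSets_inter (hSb hs) (hRb hr)
  · rintro _ ⟨s, hs, r, hr, rfl⟩ _ ⟨s', hs', r', hr', rfl⟩ hne
    by_cases h : s = s'
    · subst h
      have hrr : r ≠ r' := by rintro rfl; exact hne rfl
      exact (hRd hr hr' hrr).mono Set.inter_subset_right Set.inter_subset_right
    · exact (hSd hs hs' h).mono Set.inter_subset_left Set.inter_subset_left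
  · ext z
    constructor
    · rintro ⟨⟨s, hs, hzs⟩, r, hr, hzr⟩
      exact ⟨s ∩ r, ⟨s, hs, r, hr, rfl⟩, hzs, hzr⟩
    · rintro ⟨_, ⟨s, hs, r, hr, rfl⟩, hzs, hzr⟩
      exact ⟨⟨s, hs, hzs⟩, r, hr, hzr⟩

end RingOfSets

/-! ### Translations of the universal cover -/

section Translation

variable {a b : E}

/-- Left multiplication is a morphism of directed graphs which preserves the labels of edges. -/
def leftMulEdge (α : Arrow a b) {p q : CoverTree b} (e : p ⟶ q) : leftMul α p ⟶ leftMul α q :=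
  ⟨e.1, (congrArg (α ≫ ·) e.2).trans (Category.assoc _ _ _).symm⟩

theorem leftMul_inv_leftMul (α : Arrow a b) (p : CoverTree b) :
    leftMul (Groupoid.inv α) (leftMul α p) = p := by
  simp [leftMul]

theorem leftMul_leftMul_inv (α : Arrow a b) (p : CoverTree a) :
    leftMul α (leftMul (Groupoid.inv α) p) = p := by
  simp [leftMul]

theorem deg_leftMul (α : Arrow a b) (p : CoverTree b) :
    deg (leftMul α p) = arrowDegree α + deg p :=
  arrowDegree_comp _ _

theorem leftMul_mem_reach (α : Arrow a b) {p q : CoverTree b} (h : q ∈ reach p) :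
    leftMul α q ∈ reach (leftMul α p) := by
  obtain ⟨P⟩ := h
  induction P with
  | nil => exact mem_reach_self _
  | cons P e ih => exact reach_trans ih (edge_mem_reach (leftMulEdge α e))

theorem leftMul_mem_reach_iff (α : Arrow a b) {p q : CoverTree b} :
    leftMul α q ∈ reach (leftMul α p) ↔ q ∈ reach p := by
  refine ⟨fun h => ?_, leftMul_mem_reach α⟩
  simpa only [leftMul_inv_leftMul] using leftMul_mem_reach (Groupoid.inv α) h

theorem reach_leftMul_subset_iff (α : Arrow a b) (p : CoverTree b) (B : Set (CoverTree a)) :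
    reach (leftMul α p) ⊆ B ↔ reach p ⊆ leftMul α ⁻¹' B := by
  constructor
  · exact fun h z hz => h (leftMul_mem_reach α hz)
  · intro h z hz
    rw [← leftMul_leftMul_inv α z] at hz ⊢
    exact h ((leftMul_mem_reach_iff α).1 hz)

/-- The translate of an edge with a given origin. -/
def leftMulStar (α : Arrow a b) (p : CoverTree b) (e : Quiver.Star p) :
    Quiver.Star (leftMul α p) :=
  ⟨leftMul α e.1, leftMulEdge α e.2⟩

theorem leftMul_injective (α : Arrow a b) : Function.Injective (leftMul α) :=
  Function.LeftInverse.injective (leftMul_inv_leftMul α)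

theorem leftMul_preimage_reachAvoid (α : Arrow a b) (p : CoverTree b)
    (F : Finset (Quiver.Star (leftMul α p))) :
    ∃ G : Finset (Quiver.Star p), leftMul α ⁻¹' reachAvoid (leftMul α p) F = reachAvoid p G := by
  have hinj : Function.Injective (leftMulStar α p) := fun e f h =>
    star_ext (leftMul_injective α (congrArg Sigma.fst h))
  refine ⟨F.preimage (leftMulStar α p) hinj.injOn, ?_⟩
  ext z
  constructor
  · rintro (h | ⟨⟨q, e⟩, he, hz⟩)
    · exact Or.inl (leftMul_injective α h)
    · obtain ⟨q, rfl⟩ : ∃ q', q = leftMul α q' := ⟨_, (leftMul_leftMul_inv α q).symm⟩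
      have hq : p ⟶ q := ⟨e.1, by
        have h := e.2
        rwa [Category.assoc, cancel_epi] at h⟩
      have he' : leftMulStar α p ⟨q, hq⟩ = ⟨_, e⟩ := star_ext rfl
      refine Or.inr ⟨⟨q, hq⟩, ?_, (leftMul_mem_reach_iff α).1 hz⟩
      rwa [Finset.mem_preimage, he']
  · rintro (rfl | ⟨e, he, hz⟩)
    · exact Or.inl rfl
    · rw [Finset.mem_preimage] at he
      exact Or.inr ⟨_, he, leftMul_mem_reach α hz⟩

theorem leftMul_preimage_mem_setRing (α : Arrow a b) {B : Set (CoverTree a)}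
    (hB : B ∈ setRing (CoverTree a)) : leftMul α ⁻¹' B ∈ setRing (CoverTree b) := by
  obtain ⟨S, hSf, hSb, hSd, rfl⟩ := hB
  refine ⟨(fun s => leftMul α ⁻¹' s) '' S, hSf.image _, ?_, ?_, ?_⟩
  · rintro _ ⟨s, hs, rfl⟩
    obtain rfl | ⟨p, F, rfl⟩ := hSb hs
    · exact Or.inl rfl
    · obtain ⟨p, rfl⟩ : ∃ p', p = leftMul α p' := ⟨_, (leftMul_leftMul_inv α p).symm⟩
      exact Or.inr ⟨p, leftMul_preimage_reachAvoid α p F⟩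
  · rintro _ ⟨s, hs, rfl⟩ _ ⟨r, hr, rfl⟩ hne
    have hsr : s ≠ r := by rintro rfl; exact hne rfl
    exact Disjoint.preimage _ (hSd hs hr hsr)
  · rw [Set.sUnion_image, Set.preimage_sUnion]

theorem leftMul_preimage_mem_setRing_iff (α : Arrow a b) {B : Set (CoverTree a)} :
    leftMul α ⁻¹' B ∈ setRing (CoverTree b) ↔ B ∈ setRing (CoverTree a) := by
  refine ⟨fun h => ?_, leftMul_preimage_mem_setRing α⟩
  have h' := leftMul_preimage_mem_setRing (Groupoid.inv α) h
  rwa [← Set.preimage_comp, show leftMul α ∘ leftMul (Groupoid.inv α) = id from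
    funext (leftMul_leftMul_inv α), Set.preimage_id] at h'

end Translation

/-! ### Infinite directed paths -/

namespace InfPath

/-- The infinite path without its first `n` edges. -/
def drop {T : Type*} [Quiver T] (x : InfPath T) (n : ℕ) : InfPath T where
  vert i := x.vert (n + i)
  edge i := x.edge (n + i)

/-- The infinite path with one more edge in front. -/
def cons {T : Type*} [Quiver T] {p : T} (x : InfPath T) (e : p ⟶ x.vert 0) : InfPath T where
  vert
    | 0 => p
    | n + 1 => x.vert n
  edge
    | 0 => e
    | n + 1 => x.edge n

/-- An infinite path can be extended backwards along a finite path. -/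
theorem exists_prepend {T : Type*} [Quiver T] {p : T} (x : InfPath T) (h : x.vert 0 ∈ reach p) :
    ∃ (y : InfPath T) (n : ℕ), y.vert 0 = p ∧ ∀ i, y.vert (n + i) = x.vert i := by
  obtain ⟨P⟩ := h
  generalize hq : x.vert 0 = q at P
  induction P generalizing x with
  | nil => exact ⟨x, 0, hq, fun i => by rw [Nat.zero_add]⟩
  | cons P e ih =>
    subst hq
    obtain ⟨y, n, hy, hn⟩ := ih (x.cons e) rfl
    refine ⟨y, n + 1, hy, fun i => ?_⟩
    rw [Nat.add_assoc, Nat.add_comm 1, hn]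
    rfl

theorem reach_vert {T : Type*} [Quiver T] (x : InfPath T) {m n : ℕ} (h : m ≤ n) :
    x.vert n ∈ reach (x.vert m) := by
  induction n, h using Nat.le_induction with
  | base => exact mem_reach_self _
  | succ n _ ih => exact reach_trans ih (edge_mem_reach (x.edge n))

theorem reach_vert_subset {T : Type*} [Quiver T] (x : InfPath T) {m n : ℕ} (h : m ≤ n) :
    reach (x.vert n) ⊆ reach (x.vert m) :=
  reach_subset (x.reach_vert h)

theorem deg_vert {o : E} (x : InfPath (CoverTree o)) (n : ℕ) :
    deg (x.vert n) = deg (x.vert 0) + n := by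
  induction n with
  | zero => simp
  | succ n ih => rw [deg_edge (x.edge n), ih]; push_cast; ring

/-- The translate of an infinite path in the universal cover. -/
def translate {a b : E} (α : Arrow a b) (x : InfPath (CoverTree b)) : InfPath (CoverTree a) where
  vert n := leftMul α (x.vert n)
  edge n := leftMulEdge α (x.edge n)

end InfPath

/-- Infinite paths with a common tail define the same point. -/
theorem pathFilter_congr {T : Type*} [Quiver T] {x y : InfPath T} {m n : ℕ}
    (h : ∀ i, x.vert (m + i) = y.vert (n + i)) : pathFilter x = pathFilter y := by
  have key : ∀ {x y : InfPath T} {m n : ℕ}, (∀ i, x.vert (m + i) = y.vert (n + i)) →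
      pathFilter x ⊆ pathFilter y := by
    rintro x y m n h B ⟨hB, j, hj⟩
    refine ⟨hB, n + j, ?_⟩
    rw [← h]
    exact (x.reach_vert_subset (Nat.le_add_left j m)).trans hj
  exact (key h).antisymm (key fun i => (h i).symm)

theorem mem_pathFilter_translate {a b : E} (α : Arrow a b) (x : InfPath (CoverTree b))
    (B : Set (CoverTree a)) :
    B ∈ pathFilter (x.translate α) ↔ leftMul α ⁻¹' B ∈ pathFilter x :=
  and_congr (leftMul_preimage_mem_setRing_iff α).symm
    (exists_congr fun _ => reach_leftMul_subset_iff α _ B)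

theorem reach_mem_pathFilter {T : Type*} [Quiver T] (x : InfPath T) (n : ℕ) :
    reach (x.vert n) ∈ pathFilter x :=
  ⟨reach_mem_setRing _, n, subset_rfl⟩

section PathPoint

variable {o : E}

/-- If `V(p;F)` contains no `V(x.vert n)`, then it is disjoint from one of them. This is what makes
the filter given by an infinite path maximal. -/
theorem exists_disjoint_reachAvoid (x : InfPath (CoverTree o)) (p : CoverTree o)
    (F : Finset (Quiver.Star p)) (h : ∀ n, ¬ reach (x.vert n) ⊆ reachAvoid p F) :
    ∃ n, Disjoint (reachAvoid p F) (reach (x.vert n)) := by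
  by_contra! hd
  simp only [Set.not_disjoint_iff] at hd
  choose z hzp hzx using hd
  -- The descendants of both `x.vert 0` and `p` are those of `m`, and the path runs through `m`.
  obtain ⟨m, hmx, hmp, hm⟩ := exists_join (hzx 0) (reachAvoid_subset_reach _ _ (hzp 0))
  obtain ⟨P⟩ := hmx
  have key : x.vert P.length = m := by
    refine eq_of_deg_eq (x.reach_vert (Nat.zero_le _)) (hzx _) ⟨P⟩
      (hm _ (reach_trans (x.reach_vert (Nat.zero_le _)) (hzx P.length))
        (reachAvoid_subset_reach _ _ (hzp P.length))) ?_
    rw [x.deg_vert, deg_path P]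
  have hnext : x.vert (P.length + 1) ∈ reach p :=
    reach_trans (key.symm ▸ hmp) (edge_mem_reach (x.edge P.length))
  have hne : x.vert (P.length + 1) ≠ p := by
    intro he
    have h1 := deg_le_of_reach hmp
    rw [← key] at h1
    have h2 := deg_edge (x.edge P.length)
    rw [he] at h2
    omega
  obtain h1 | h1 := reach_subset_or_disjoint F hnext hne
  · exact h _ h1
  · exact Set.disjoint_left.1 h1 (hzp _) (hzx _)

theorem isRingFilter_pathFilter (x : InfPath (CoverTree o)) : IsRingFilter (pathFilter x) where
  subset _ h := h.1
  nonempty := ⟨_, reach_mem_pathFilter x 0⟩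
  empty_notMem := by
    rintro ⟨-, j, hj⟩
    exact hj (mem_reach_self _)
  inter_mem := by
    rintro B ⟨hB, i, hi⟩ C ⟨hC, j, hj⟩
    exact ⟨setRing_inter hB hC, max i j, Set.subset_inter
      ((x.reach_vert_subset (le_max_left i j)).trans hi)
      ((x.reach_vert_subset (le_max_right i j)).trans hj)⟩
  mem_of_superset := by
    rintro B ⟨-, i, hi⟩ C hC hBC
    exact ⟨hC, i, hi.trans hBC⟩

theorem pathFilter_maximal (x : InfPath (CoverTree o)) (U : Set (Set (CoverTree o)))
    (hU : IsRingFilter U) (hle : pathFilter x ⊆ U) : U = pathFilter x := by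
  refine Set.Subset.antisymm (fun B hB => ?_) hle
  refine ⟨hU.subset hB, ?_⟩
  by_contra! hn
  obtain ⟨S, hSf, hSb, -, hBS⟩ := hU.subset hB
  have hev : ∀ s ∈ S, ∀ᶠ n in Filter.atTop, Disjoint s (reach (x.vert n)) := by
    intro s hs
    have hsB : s ⊆ B := hBS ▸ Set.subset_sUnion_of_mem hs
    obtain rfl | ⟨p, F, rfl⟩ := hSb hs
    · simp
    · obtain ⟨n, h⟩ := exists_disjoint_reachAvoid x p F fun n h => hn n (h.trans hsB)
      filter_upwards [Filter.eventually_ge_atTop n] with k hk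
      exact h.mono_right (x.reach_vert_subset hk)
  obtain ⟨n, h⟩ := ((Filter.eventually_all_finite hSf).2 hev).exists
  have hdisj : B ∩ reach (x.vert n) = ∅ := by
    rw [← Set.disjoint_iff_inter_eq_empty, hBS, Set.disjoint_sUnion_left]
    exact h
  exact hU.empty_notMem (hdisj ▸ hU.inter_mem _ hB _ (hle (reach_mem_pathFilter x n)))

/-- The point of the Stone space given by an infinite directed path. -/
def pathSpec (x : InfPath (CoverTree o)) : Spec (CoverTree o) where
  sets := pathFilter x
  isFilter := isRingFilter_pathFilter x
  maximal := pathFilter_maximal x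

/-- The unit of the graph groupoid given by an infinite directed path that starts at a root. -/
def pathPoint (x : InfPath (CoverTree o)) (hx : x.vert 0 = root o) : UnitSpace E :=
  ⟨⟨o, pathSpec x, subset_closure (Or.inl ⟨x, rfl⟩)⟩, Or.inr ⟨x, hx, rfl⟩⟩

/-- The sets `[V(x.vert n)]` form a neighbourhood basis of the point given by `x`. -/
theorem exists_reach_of_isOpen {s : Spec (CoverTree o)} {x : InfPath (CoverTree o)}
    (hs : s.sets = pathFilter x) {O : Set (Spec (CoverTree o))} (hO : IsOpen O) (hsO : s ∈ O) :
    ∃ n, ∀ t : Spec (CoverTree o), reach (x.vert n) ∈ t.sets → t ∈ O := by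
  induction hO with
  | basic O h =>
    obtain ⟨B, hB, rfl⟩ := h
    have hsB : B ∈ s.sets := hsO
    rw [hs] at hsB
    obtain ⟨-, n, hn⟩ := hsB
    exact ⟨n, fun t ht => t.isFilter.mem_of_superset _ ht _ hB hn⟩
  | univ => exact ⟨0, fun _ _ => trivial⟩
  | inter O O' _ _ ih ih' =>
    obtain ⟨n, hn⟩ := ih hsO.1
    obtain ⟨m, hm⟩ := ih' hsO.2
    refine ⟨max n m, fun t ht => ⟨hn t ?_, hm t ?_⟩⟩
    · exact t.isFilter.mem_of_superset _ ht _ (reach_mem_setRing _)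
        (x.reach_vert_subset (le_max_left n m))
    · exact t.isFilter.mem_of_superset _ ht _ (reach_mem_setRing _)
        (x.reach_vert_subset (le_max_right n m))
  | sUnion S _ ih =>
    obtain ⟨O, hOS, hsO⟩ := hsO
    obtain ⟨n, hn⟩ := ih O hOS hsO
    exact ⟨n, fun t ht => ⟨O, hOS, hn t ht⟩⟩

end PathPoint

/-! ### Isotropy of the graph groupoid -/

/-- A sequence that is periodic from some index on. -/
def EventuallyPeriodic {α : Type*} (t : ℕ → α) : Prop :=
  ∃ n k, 0 < k ∧ ∀ i, t (n + k + i) = t (n + i)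

/-- The edges of `E` that label the edges of an infinite path in the universal cover. -/
def InfPath.labels {o : E} (x : InfPath (CoverTree o)) (n : ℕ) : Quiver.Total E :=
  edgeTotal (x.edge n)

theorem edgeTotal_congr {o : E} {p q p' q' : CoverTree o} (e : p ⟶ q) (e' : p' ⟶ q')
    (hp : p = p') (hq : q = q') : edgeTotal e = edgeTotal e' := by
  subst hp hq
  rw [edge_subsingleton e e']

theorem InfPath.labels_congr {o : E} {x y : InfPath (CoverTree o)} {m n : ℕ}
    (h : ∀ i, x.vert (m + i) = y.vert (n + i)) (i : ℕ) :
    x.labels (m + i) = y.labels (n + i) :=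
  edgeTotal_congr _ _ (h i) (h (i + 1))

theorem InfPath.vert_congr {o : E} {x y : InfPath (CoverTree o)} {m n : ℕ}
    (h0 : x.vert m = y.vert n) (h : ∀ i, x.labels (m + i) = y.labels (n + i)) (i : ℕ) :
    x.vert (m + i) = y.vert (n + i) := by
  induction i with
  | zero => exact h0
  | succ i ih =>
    have key : ∀ {p p' q q' : CoverTree o} (e : p ⟶ q) (e' : p' ⟶ q'), p = p' →
        edgeTotal e = edgeTotal e' → q = q' := by
      rintro p _ q q' e e' rfl he
      exact edge_target_unique e e' he
    exact key _ _ ih (h i)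

theorem eq_id_of_leftMul_eq {o : E} {α : Arrow o o} {p : CoverTree o} (h : leftMul α p = p) :
    α = 𝟙 _ := by
  obtain ⟨t, x⟩ := p
  have h' : α ≫ x = x := by simpa [leftMul] using h
  rwa [← cancel_mono x, Category.id_comp]

/-- An arrow that fixes the point given by an infinite path `x` shifts `x`. -/
theorem eq_id_or_eventuallyPeriodic {o : E} {x : InfPath (CoverTree o)} {α : Arrow o o}
    (h : ∀ B, B ∈ pathFilter x ↔ leftMul α ⁻¹' B ∈ pathFilter x) :
    α = 𝟙 _ ∨ EventuallyPeriodic x.labels := by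
  have hx : ∀ n, ∃ j, x.vert n ∈ reach (x.vert 0) ∧
      ∀ i, j ≤ i → leftMul α (x.vert i) ∈ reach (x.vert n) := by
    intro n
    obtain ⟨-, j, hj⟩ := (h _).1 (reach_mem_pathFilter x n)
    exact ⟨j, x.reach_vert (Nat.zero_le n), fun i hi => hj (x.reach_vert hi)⟩
  choose J hJ0 hJ using hx
  have hd : deg (x.vert 0) ≤ deg (leftMul α (x.vert (J 0))) :=
    deg_le_of_reach (hJ 0 _ le_rfl)
  rw [deg_leftMul, x.deg_vert (J 0)] at hd
  obtain ⟨N, hN⟩ : ∃ N : ℕ, (N : ℤ) = arrowDegree α + J 0 :=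
    ⟨(arrowDegree α + J 0).toNat, Int.toNat_of_nonneg (by omega)⟩
  have key : ∀ i, leftMul α (x.vert (J 0 + i)) = x.vert (N + i) := by
    intro i
    -- Both vertices lie between `x.vert 0` and a remote vertex of the translated path.
    set M := max (J 0 + i) (J (N + i))
    refine eq_of_deg_eq (hJ 0 _ (Nat.le_add_right _ i))
      (leftMul_mem_reach α (x.reach_vert (le_max_left _ _ : _ ≤ M)))
      (hJ0 _) (hJ (N + i) M (le_max_right _ _)) ?_
    rw [deg_leftMul, x.deg_vert, x.deg_vert (N + i)]
    push_cast
    omega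
  have hlab : ∀ i, x.labels (J 0 + i) = x.labels (N + i) := by
    intro i
    exact (x.translate α).labels_congr (y := x) key i
  obtain hlt | heq | hlt := lt_trichotomy (J 0) N
  · right
    refine ⟨J 0, N - J 0, by omega, fun i => ?_⟩
    rw [hlab, Nat.add_sub_cancel' hlt.le]
  · left
    have := key 0
    rw [heq] at this
    exact eq_id_of_leftMul_eq this
  · right
    refine ⟨N, J 0 - N, by omega, fun i => ?_⟩
    rw [← hlab, Nat.add_sub_cancel' hlt.le]

theorem eq_id_of_vertexFilter {o : E} {p : CoverTree o} {α : Arrow o o}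
    (h : ∀ B, B ∈ vertexFilter p ↔ leftMul α ⁻¹' B ∈ vertexFilter p) : α = 𝟙 _ := by
  have hF : ∀ F, leftMul α p ∈ reachAvoid p F := fun F =>
    ((h _).1 ⟨reachAvoid_mem_setRing p F, self_mem_reachAvoid p F⟩).2
  refine eq_id_of_leftMul_eq (p := p) ?_
  by_contra hne
  obtain ⟨e, he⟩ := exists_star_of_reach (reachAvoid_subset_reach p ∅ (hF ∅)) hne
  obtain h1 | ⟨f, hf, hz⟩ := hF {e}
  · exact hne h1
  · exact hf (Finset.mem_singleton.2 (star_unique hz he))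

/-- Units of the graph groupoid with trivial isotropy. -/
def TrivialIsotropy (X : UnitSpace E) : Prop :=
  ∀ α : Arrow X.1.1 X.1.1, IsTranslate X.1 X.1 α → α = 𝟙 _

theorem essentiallyFree_restriction_iff (K : Set (UnitSpace E)) :
    let _ := graphGroupoid E
    @EssentiallyFree K _ (restriction K) ↔ Dense {x : K | TrivialIsotropy x.1} := by
  let _ := graphGroupoid E
  have : {x : K | ∀ g : (restriction K).Hom x x, g = (restriction K).id x} =
      {x : K | TrivialIsotropy x.1} := by
    ext x
    exact ⟨fun h α hα => congrArg Subtype.val (h ⟨α, hα⟩),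
      fun h g => Subtype.ext (h g.1 g.2)⟩
  rw [← this]
  rfl

theorem eq_pathPoint (X : UnitSpace E) (x : InfPath (CoverTree X.1.1))
    (hx : x.vert 0 = root X.1.1) (hs : X.1.2.1.sets = pathFilter x) : X = pathPoint x hx :=
  Subtype.ext (Sigma.ext rfl (heq_of_eq (Subtype.ext (Spec.ext hs))))

/-- A point of the graph groupoid with nontrivial isotropy is given by an eventually periodic
infinite path. -/
theorem exists_eventuallyPeriodic {X : UnitSpace E} (hX : ¬ TrivialIsotropy X) :
    ∃ (o : E) (x : InfPath (CoverTree o)) (hx : x.vert 0 = root o), X = pathPoint x hx ∧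
      EventuallyPeriodic x.labels := by
  simp only [TrivialIsotropy, not_forall] at hX
  obtain ⟨α, hα, hne⟩ := hX
  obtain ⟨p, -, hp⟩ | ⟨x, hx, hs⟩ := X.2
  · refine absurd (eq_id_of_vertexFilter (p := p) fun B => ?_) hne
    rw [← hp]
    exact hα B
  · refine ⟨_, x, hx, eq_pathPoint X x hx hs,
      (eq_id_or_eventuallyPeriodic fun B => ?_).resolve_left hne⟩
    rw [← hs]
    exact hα B

theorem trivialIsotropy_pathPoint {o : E} {x : InfPath (CoverTree o)} (hx : x.vert 0 = root o)
    (h : ¬ EventuallyPeriodic x.labels) : TrivialIsotropy (pathPoint x hx) :=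
  fun _ hα => (eq_id_or_eventuallyPeriodic (x := x) hα).resolve_right h

/-! ### Infinite paths in the graph -/

theorem exists_edge_lift {o : E} (p : CoverTree o) (f : Quiver.Total E)
    (h : f.left = p.terminus) : ∃ (q : CoverTree o) (e : p ⟶ q), edgeTotal e = f := by
  obtain ⟨t, x⟩ := p
  obtain ⟨a, b, e⟩ := f
  obtain rfl : a = t := h
  exact ⟨⟨b, x ≫ edgeArrow e⟩, ⟨e, rfl⟩, rfl⟩

/-- Every infinite path in `E` lifts to the universal cover. -/
theorem exists_lift {o : E} (p : CoverTree o) (t : ℕ → Quiver.Total E)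
    (ht : ∀ n, (t n).right = (t (n + 1)).left) (h : (t 0).left = p.terminus) :
    ∃ x : InfPath (CoverTree o), x.vert 0 = p ∧ ∀ n, x.labels n = t n := by
  choose nxt e he using fun n (q : {q : CoverTree o // (t n).left = q.terminus}) =>
    exists_edge_lift q.1 (t n) q.2
  let S : ∀ n, {q : CoverTree o // (t n).left = q.terminus} := fun n =>
    Nat.rec ⟨p, h⟩ (fun n q => ⟨nxt n q, by rw [← ht, ← he n q]; rfl⟩) n
  exact ⟨⟨fun n => (S n).1, fun n => e n (S n)⟩, rfl, fun n => he n (S n)⟩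

theorem total_reach {t : ℕ → Quiver.Total E} (ht : ∀ n, (t n).right = (t (n + 1)).left)
    {m n : ℕ} (h : m ≤ n) : (t n).left ∈ reach (t m).left := by
  induction n, h using Nat.le_induction with
  | base => exact mem_reach_self _
  | succ n _ ih => exact ht n ▸ reach_trans ih (edge_mem_reach (t n).hom)

/-- If there is neither a terminal nor a transitory cycle, then some vertex on a given closed path
is the origin of a second edge from which the closed path can be reached again. -/
theorem exists_returning_edge (hE : ¬ ∃ c : DirCycle E, c.IsTerminal ∨ c.IsTransitory)
    {t : ℕ → Quiver.Total E} (ht : ∀ n, (t n).right = (t (n + 1)).left) {k : ℕ} (hk : 0 < k)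
    (hper : ∀ i, t (i + k) = t i) :
    ∃ i f, f.left = (t i).left ∧ f ≠ t i ∧ (t i).left ∈ reach f.right := by
  classical
  by_contra! H
  have hmul : ∀ i j, t (i + k * j) = t i := by
    intro i j
    induction j with
    | zero => simp
    | succ j ih => rw [Nat.mul_succ, ← Nat.add_assoc, hper, ih]
  have hreach : ∀ i j, (t i).left ∈ reach (t j).left := by
    intro i j
    rw [← hmul i j]
    exact total_reach ht (le_trans (Nat.le_mul_of_pos_left j hk) (Nat.le_add_left _ i))
  have hunique : ∀ i f, f.left = (t i).left → (t i).left ∈ reach f.right → f = t i := by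
    intro i f h1 h2
    by_contra h3
    exact H i f h1 h3 h2
  have hdet : ∀ i j, (t i).left = (t j).left → ∀ s, t (i + s) = t (j + s) := by
    intro i j h s
    induction s with
    | zero => exact hunique j (t i) h (by rw [ht]; exact hreach _ _)
    | succ s ih =>
      refine hunique (j + (s + 1)) _ ?_ (by rw [ht]; exact hreach _ _)
      rw [← Nat.add_assoc, ← Nat.add_assoc, ← ht, ← ht, ih]
  have hex : ∃ n, (t (n + 1)).left = (t 0).left :=
    ⟨k - 1, by rw [Nat.sub_add_cancel hk, ← hper 0, Nat.zero_add]⟩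
  -- The first return to the initial vertex closes a cycle, since an earlier repetition of a vertex
  -- would force an earlier return.
  obtain ⟨n, hn, hmin⟩ : ∃ n, (t (n + 1)).left = (t 0).left ∧
      ∀ m < n, (t (m + 1)).left ≠ (t 0).left :=
    ⟨Nat.find hex, Nat.find_spec hex, fun m hm => Nat.find_min hex hm⟩
  have hlt : ∀ i j, i < j → j ≤ n → (t i).left ≠ (t j).left := by
    intro i j hij hjn h
    have h1 := hdet i j h (n + 1 - j)
    rw [Nat.add_sub_cancel' (by omega)] at h1
    refine hmin (i + (n + 1 - j) - 1) (by omega) ?_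
    rw [Nat.sub_add_cancel (by omega), h1, hn]
  let c : DirCycle E :=
    { len := n
      edge := fun i => t i
      chain := by
        intro i
        rw [ht]
        by_cases hi : i = Fin.last n
        · subst hi
          simpa using hn
        · rw [Fin.val_add_one_of_lt (Fin.lt_last_iff_ne_last.2 hi)]
      origins_injective := by
        intro i j hij
        obtain h | h | h := lt_trichotomy i j
        · exact absurd hij (hlt i j h (Nat.lt_succ_iff.1 j.2))
        · exact h
        · exact absurd hij.symm (hlt j i h (Nat.lt_succ_iff.1 i.2)) }
  have hnone : ∀ f, c.IsExit f → ∀ j, (c.edge j).left ∉ reach f.right := by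
    rintro f ⟨i, hi, hne⟩ j hj
    exact hne (hunique i f hi (reach_trans hj (hreach _ _)))
  by_cases hterm : c.IsTerminal
  · exact hE ⟨c, Or.inl hterm⟩
  · exact hE ⟨c, Or.inr ⟨hterm, hnone⟩⟩

/-- The first edge of a shortest path towards `w`. -/
theorem exists_edge_towards {w b : E} (h : w ∈ reach b) (hne : b ≠ w) :
    ∃ f : Quiver.Total E, f.left = b ∧ w ∈ reach f.right ∧
      sInf {n | ∃ P : Quiver.Path f.right w, P.length = n} <
        sInf {n | ∃ P : Quiver.Path b w, P.length = n} := by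
  obtain ⟨P⟩ := h
  obtain ⟨Q, hQ⟩ : ∃ Q : Quiver.Path b w,
      Q.length = sInf {n | ∃ P : Quiver.Path b w, P.length = n} :=
    Nat.sInf_mem (s := {n | ∃ P : Quiver.Path b w, P.length = n}) ⟨_, P, rfl⟩
  have hfirst : ∀ {z : E} (Q : Quiver.Path b z), 0 < Q.length →
      ∃ (c : E) (_ : b ⟶ c) (R : Quiver.Path c z), R.length + 1 = Q.length := by
    intro z Q
    induction Q with
    | nil => simp
    | cons Q e ih =>
      intro _
      cases Q with
      | nil => exact ⟨_, e, .nil, rfl⟩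
      | cons Q f =>
        obtain ⟨c, d, R, hR⟩ := ih (by simp)
        exact ⟨c, d, R.cons e, congrArg (· + 1) hR⟩
  obtain ⟨c, e, R, hR⟩ := hfirst Q (Nat.pos_of_ne_zero fun h0 =>
    hne (Quiver.Path.eq_of_length_zero Q h0))
  refine ⟨⟨b, c, e⟩, rfl, ⟨R⟩, ?_⟩
  rw [← hQ, ← hR]
  exact Nat.lt_succ_of_le (Nat.sInf_le ⟨R, rfl⟩)

/-- If two distinct edges `f`, `g` with origin `w` lead back to `w`, then there is an infinite path
that is not eventually periodic and always can return to `w`. It is found by a diagonal argument: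
the path visits `w` again and again, and the edge chosen at a visit is `f` or `g`, whichever
differs from the edge `k` steps earlier, where each `k > 0` gets its turn infinitely often. -/
theorem exists_not_eventuallyPeriodic {w : E} {f g : Quiver.Total E} (hfg : f ≠ g)
    (hf : f.left = w) (hg : g.left = w) (hfw : w ∈ reach f.right) (hgw : w ∈ reach g.right)
    {b : E} (hb : w ∈ reach b) :
    ∃ t : ℕ → Quiver.Total E, (∀ n, (t n).right = (t (n + 1)).left) ∧ (t 0).left = b ∧
      ¬ EventuallyPeriodic t ∧ ∀ n, w ∈ reach (t n).left := by
  classical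
  choose step hstepl hstepr hstepd using
    fun (c : {c : E // w ∈ reach c}) (h : c.1 ≠ w) => exists_edge_towards c.2 h
  -- A state consists of the present vertex, the edges passed so far (the last one first), and the
  -- number of visits to `w`.
  let choice : {c : E // w ∈ reach c} → List (Quiver.Total E) → ℕ → Quiver.Total E :=
    fun c l j => if h : c.1 = w then (if l[j.unpair.1]? = some f then g else f) else step c h
  have hleft : ∀ c l j, (choice c l j).left = c.1 := by
    intro c l j
    simp only [choice]
    split_ifs with h h'
    · rw [hg, h]
    · rw [hf, h]
    · exact hstepl c h
  have hright : ∀ c l j, w ∈ reach (choice c l j).right := by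
    intro c l j
    simp only [choice]
    split_ifs with h h'
    · exact hgw
    · exact hfw
    · exact hstepr c h
  let S : ℕ → {c : E // w ∈ reach c} × List (Quiver.Total E) × ℕ := fun n =>
    Nat.rec (⟨b, hb⟩, [], 0) (fun _ s => (⟨(choice s.1 s.2.1 s.2.2).right, hright _ _ _⟩,
      choice s.1 s.2.1 s.2.2 :: s.2.1, if s.1.1 = w then s.2.2 + 1 else s.2.2)) n
  let t : ℕ → Quiver.Total E := fun n => choice (S n).1 (S n).2.1 (S n).2.2
  have hSl : ∀ n, (S (n + 1)).2.1 = t n :: (S n).2.1 := fun _ => rfl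
  have hSr : ∀ n, (S (n + 1)).1.1 = (t n).right := fun _ => rfl
  have hSj : ∀ n, (S (n + 1)).2.2 = if (S n).1.1 = w then (S n).2.2 + 1 else (S n).2.2 :=
    fun _ => rfl
  have hist : ∀ n i, (S (n + 1 + i)).2.1[i]? = some (t n) := by
    intro n i
    induction i with
    | zero => rw [Nat.add_zero, hSl]; rfl
    | succ i ih => rw [← Nat.add_assoc, hSl, List.getElem?_cons_succ, ih]
  have visit : ∀ d n, sInf {m | ∃ P : Quiver.Path (S n).1.1 w, P.length = m} ≤ d →
      ∃ m, n ≤ m ∧ (S m).1.1 = w ∧ (S m).2.2 = (S n).2.2 := by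
    intro d
    induction d with
    | zero =>
      intro n hd
      by_cases h : (S n).1.1 = w
      · exact ⟨n, le_rfl, h, rfl⟩
      · exact absurd (hstepd (S n).1 h) (by omega)
    | succ d ih =>
      intro n hd
      by_cases h : (S n).1.1 = w
      · exact ⟨n, le_rfl, h, rfl⟩
      · have ht : t n = step (S n).1 h := dif_neg h
        have h1 := hstepd (S n).1 h
        rw [← ht] at h1
        obtain ⟨m, hm, hmw, hmj⟩ := ih (n + 1) (by rw [hSr]; omega)
        exact ⟨m, by omega, hmw, by rw [hmj, hSj, if_neg h]⟩
  have visits : ∀ J, ∃ m, J ≤ m ∧ (S m).1.1 = w ∧ (S m).2.2 = J := by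
    intro J
    induction J with
    | zero =>
      obtain ⟨m, hm, hmw, hmj⟩ := visit _ 0 le_rfl
      exact ⟨m, hm, hmw, hmj⟩
    | succ J ih =>
      obtain ⟨m, hm, hmw, hmj⟩ := ih
      obtain ⟨m', hm', hmw', hmj'⟩ := visit _ (m + 1) le_rfl
      exact ⟨m', by omega, hmw', by rw [hmj', hSj, if_pos hmw, hmj]⟩
  refine ⟨t, fun n => (hSr n).symm.trans (hleft _ _ _).symm, hleft _ _ _, ?_, fun n => ?_⟩
  · rintro ⟨n, k, hk, hper⟩
    obtain ⟨m, hm, hmw, hmj⟩ := visits (Nat.pair (k - 1) (n + k))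
    have hnm : n + k ≤ m := (Nat.right_le_pair _ _).trans hm
    obtain ⟨i, rfl⟩ := Nat.exists_eq_add_of_le hnm
    have h1 := hist (n + i) (k - 1)
    rw [show n + i + 1 + (k - 1) = n + k + i by omega] at h1
    have h2 : t (n + k + i) = if t (n + i) = f then g else f := by
      change choice _ _ _ = _
      simp only [choice]
      rw [dif_pos hmw, hmj, Nat.unpair_pair, h1]
      simp only [Option.some.injEq]
    rw [hper] at h2
    split_ifs at h2 with h3
    · exact hfg (h3.symm.trans h2)
    · exact h3 h2
  · rw [hleft]
    exact (S n).1.2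

/-! ### Closed invariant sets of units -/

/-- Neighbourhoods of `pathPoint x` contain all points given by paths through some `x.vert n`. -/
theorem exists_pathPoint_mem_of_isOpen {o : E} {x : InfPath (CoverTree o)} (hx : x.vert 0 = root o)
    {U : Set (UnitSpace E)} (hU : IsOpen U) (hxU : pathPoint x hx ∈ U) :
    ∃ n, ∀ (y : InfPath (CoverTree o)) (hy : y.vert 0 = root o) (m : ℕ),
      y.vert m ∈ reach (x.vert n) → pathPoint y hy ∈ U := by
  obtain ⟨O, hO, rfl⟩ := isOpen_induced_iff.1 hU
  have hOo : IsOpen (Sigma.mk o ⁻¹' O) := isOpen_sigma_iff.1 hO o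
  obtain ⟨O', hO', hOO'⟩ := isOpen_induced_iff.1 hOo
  have hmem : ∀ (y : InfPath (CoverTree o)) (hy : y.vert 0 = root o),
      pathSpec y ∈ O' ↔ pathPoint y hy ∈ Subtype.val ⁻¹' O := by
    intro y hy
    have := Set.ext_iff.1 hOO' ⟨pathSpec y, subset_closure (Or.inl ⟨y, rfl⟩)⟩
    exact this
  obtain ⟨n, hn⟩ := exists_reach_of_isOpen (x := x) (s := pathSpec x) rfl hO' ((hmem x hx).2 hxU)
  exact ⟨n, fun y hy m hm =>
    (hmem y hy).1 (hn _ ⟨reach_mem_setRing _, m, reach_subset hm⟩)⟩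

theorem pathPoint_mem_of_isInvariant {K : Set (UnitSpace E)}
    (hK : @IsInvariant (UnitSpace E) (graphGroupoid E) K) {a b : E}
    {x : InfPath (CoverTree b)} (hx : x.vert 0 = root b) (hxK : pathPoint x hx ∈ K)
    {y : InfPath (CoverTree a)} (hy : y.vert 0 = root a) (α : Arrow a b) {m n : ℕ}
    (h : ∀ i, y.vert (m + i) = leftMul α (x.vert (n + i))) : pathPoint y hy ∈ K := by
  have key : ∀ B, B ∈ pathFilter y ↔ leftMul α ⁻¹' B ∈ pathFilter x := fun B => by
    rw [← mem_pathFilter_translate, pathFilter_congr (y := x.translate α) h]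
  exact @hK (pathPoint x hx) (pathPoint y hy) ⟨α, key⟩ hxK

theorem exists_reach_lift {o : E} (p : CoverTree o) {c : E} (h : c ∈ reach p.terminus) :
    ∃ q ∈ reach p, q.terminus = c := by
  obtain ⟨P⟩ := h
  induction P with
  | nil => exact ⟨p, mem_reach_self p, rfl⟩
  | cons P e ih =>
    obtain ⟨q, hq, rfl⟩ := ih
    exact ⟨⟨_, q.path ≫ edgeArrow e⟩, reach_trans hq (edge_mem_reach ⟨e, rfl⟩), rfl⟩

theorem terminus_mem_reach {o : E} {p q : CoverTree o} (h : q ∈ reach p) :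
    q.terminus ∈ reach p.terminus := by
  obtain ⟨P⟩ := h
  induction P with
  | nil => exact mem_reach_self _
  | cons P e ih => exact reach_trans ih (edge_mem_reach e.1)

theorem exists_leftMul_eq {a b : E} {p : CoverTree a} {q : CoverTree b}
    (h : p.terminus = q.terminus) : ∃ α : Arrow a b, leftMul α q = p := by
  obtain ⟨t, x⟩ := p
  obtain ⟨t', y⟩ := q
  obtain rfl : t = t' := h
  exact ⟨x ≫ Groupoid.inv y, by simp [leftMul]⟩

/-- Without terminal and transitory cycles, points with trivial isotropy are dense in every closed
invariant set: a periodic path is approximated by paths that follow it for a long time and are not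
eventually periodic, without ever losing the way back to the closed path. They are limits of paths
that do return and are eventually periodic, so they belong to the closed invariant set. -/
theorem dense_trivialIsotropy (hE : ¬ ∃ c : DirCycle E, c.IsTerminal ∨ c.IsTransitory)
    {K : Set (UnitSpace E)} (hKc : IsClosed K)
    (hK : @IsInvariant (UnitSpace E) (graphGroupoid E) K) :
    Dense {X : K | TrivialIsotropy X.1} := by
  rintro ⟨X, hXK⟩
  by_cases hX : TrivialIsotropy X
  · exact subset_closure hX
  rw [mem_closure_iff]
  intro U hU hXU
  obtain ⟨O, hO, rfl⟩ := isOpen_induced_iff.1 hU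
  obtain ⟨o, x, hx, rfl, n₀, k, hk, hper⟩ := exists_eventuallyPeriodic hX
  obtain ⟨N, hN⟩ := exists_pathPoint_mem_of_isOpen hx hO hXU
  set t : ℕ → Quiver.Total E := fun i => x.labels (n₀ + N + i) with ht
  have hchain : ∀ i, (t i).right = (t (i + 1)).left := fun _ => rfl
  have htper : ∀ i, t (i + k) = t i := by
    intro i
    simp only [ht]
    rw [show n₀ + N + (i + k) = n₀ + k + (N + i) by omega, hper, Nat.add_assoc]
  obtain ⟨i, f, hfl, hfne, hfr⟩ := exists_returning_edge hE hchain hk htper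
  have hgr : (t i).left ∈ reach (t i).right := by
    have := total_reach hchain (show i + 1 ≤ i + k by omega)
    rwa [htper] at this
  obtain ⟨t', hchain', ht'0, ht'per, ht'r⟩ := exists_not_eventuallyPeriodic hfne hfl rfl hfr hgr
    (total_reach hchain (Nat.zero_le i))
  obtain ⟨q, hq0, hql⟩ := exists_lift (x.vert (n₀ + N)) t' hchain' ht'0
  have hroot : ∀ j, x.vert j ∈ reach (root o) := fun j => hx ▸ x.reach_vert (Nat.zero_le j)
  obtain ⟨y, m, hy, hym⟩ := q.exists_prepend (hq0 ▸ hroot (n₀ + N))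
  have hyper : ¬ EventuallyPeriodic y.labels := by
    rintro ⟨n, l, hl, hyl⟩
    refine ht'per ⟨n, l, hl, fun j => ?_⟩
    have hlab : ∀ j, y.labels (m + j) = t' j := by
      intro j
      have := InfPath.labels_congr (x := y) (y := q) (m := m) (n := 0)
        (fun j => by rw [hym, Nat.zero_add]) j
      rw [this, Nat.zero_add, hql]
    rw [← hlab, ← hlab, show m + (n + l + j) = n + l + (m + j) by omega, hyl]
    congr 1
    omega
  have hyK : pathPoint y hy ∈ K := by
    by_contra hnK
    obtain ⟨M, hM⟩ := exists_pathPoint_mem_of_isOpen hy hKc.isOpen_compl hnK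
    have hqM : (t i).left ∈ reach (q.vert M).terminus := by
      have h := ht'r M
      rw [← hql] at h
      exact h
    obtain ⟨r, hr, hrt⟩ := exists_reach_lift (q.vert M) hqM
    obtain ⟨α, hα⟩ := exists_leftMul_eq (p := r) (q := x.vert (n₀ + N + i)) hrt
    have hqy : q.vert M ∈ reach (root o) := by
      rw [← hym, ← hy]
      exact y.reach_vert (Nat.zero_le _)
    obtain ⟨z, l, hz, hzl⟩ := ((x.drop (n₀ + N + i)).translate α).exists_prepend
      (p := root o) (hα ▸ reach_trans hqy hr :
        leftMul α (x.vert (n₀ + N + i)) ∈ reach (root o))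
    refine hM z hz l ?_ (pathPoint_mem_of_isInvariant hK hx hXK hz α hzl)
    have hzr : z.vert l = r := (hzl 0).trans hα
    rw [hzr]
    refine reach_trans (y.reach_vert (Nat.le_add_left M m)) ?_
    rw [hym]
    exact hr
  refine ⟨⟨pathPoint y hy, hyK⟩, hN y hy m ?_, trivialIsotropy_pathPoint hy hyper⟩
  have hym0 : y.vert m = x.vert (n₀ + N) := (hym 0).trans hq0
  rw [hym0]
  exact x.reach_vert (Nat.le_add_left N n₀)

/-! ### The closed invariant set attached to a cycle -/

/-- The points all of whose members contain a set `V(q)` with `q` over `w`. If `w` lies on a closed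
path, this is the closure of the set of infinite paths that visit `w` infinitely often. -/
def recurrentSet (w : E) : Set (UnitSpace E) :=
  {X | ∀ B ∈ X.1.2.1.sets, ∃ q : CoverTree X.1.1, q.terminus = w ∧ reach q ⊆ B}

theorem isClosed_recurrentSet (w : E) : IsClosed (recurrentSet w) := by
  have h : IsClosed {x : CoverBoundary E | ∀ B ∈ x.2.1.sets,
      ∃ q : CoverTree x.1, q.terminus = w ∧ reach q ⊆ B} := by
    rw [isClosed_sigma_iff]
    intro o
    have : IsClosed {s : Spec (CoverTree o) | ∀ B ∈ s.sets,
        ∃ q : CoverTree o, q.terminus = w ∧ reach q ⊆ B} := by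
      simp only [Set.ofPred_forall]
      refine isClosed_iInter fun B => ?_
      by_cases hB : ∃ q : CoverTree o, q.terminus = w ∧ reach q ⊆ B
      · simp [hB]
      · simp only [hB, imp_false]
        by_cases hBR : B ∈ setRing (CoverTree o)
        · have hO : IsOpen {s : Spec (CoverTree o) | B ∈ s.sets} :=
            TopologicalSpace.isOpen_generateFrom_of_mem ⟨B, hBR, rfl⟩
          exact hO.isClosed_compl
        · convert isClosed_univ
          exact Set.eq_univ_of_forall fun s hs => hBR (s.isFilter.subset hs)
    exact this.preimage continuous_subtype_val
  exact h.preimage continuous_subtype_val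

theorem isInvariant_recurrentSet (w : E) :
    @IsInvariant (UnitSpace E) (graphGroupoid E) (recurrentSet w) := by
  intro X Y g hX B hB
  obtain ⟨α, hα⟩ := g
  obtain ⟨q, hq, hqB⟩ := hX _ ((hα B).1 hB)
  exact ⟨leftMul α q, hq, (reach_leftMul_subset_iff α q B).2 hqB⟩

namespace DirCycle

variable (c : DirCycle E)

/-- The cycle, repeated indefinitely. -/
def lap (n : ℕ) : Quiver.Total E := c.edge (Fin.ofNat (c.len + 1) n)

theorem lap_chain (n : ℕ) : (c.lap n).right = (c.lap (n + 1)).left := by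
  rw [lap, c.chain, lap]
  congr 2
  ext
  simp [Fin.val_add]

theorem lap_add_period (n : ℕ) : c.lap (n + (c.len + 1)) = c.lap n := by
  simp only [lap]
  congr 1
  ext
  simp

theorem lap_mul_period (n : ℕ) : c.lap ((c.len + 1) * n) = c.lap 0 := by
  induction n with
  | zero => rfl
  | succ n ih => rw [Nat.mul_succ, lap_add_period, ih]

variable {c}

/-- On a terminal or transitory cycle, the only edge from the `i`-th vertex that leads back to the
cycle is the `i`-th edge of the cycle. -/
theorem eq_edge_of_reach (hc : c.IsTerminal ∨ c.IsTransitory) {f : Quiver.Total E} {n : ℕ}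
    (hl : f.left = (c.lap n).left) (hr : (c.lap 0).left ∈ reach f.right) : f = c.lap n := by
  by_contra hne
  have hex : c.IsExit f := ⟨_, hl, hne⟩
  obtain h | h := hc
  · exact h f hex
  · exact h.2 f hex _ hr

/-- Points on a directed path from a terminal or transitory cycle back to it lie on the cycle. -/
theorem exists_lap_of_reach (hc : c.IsTerminal ∨ c.IsTransitory) {b : E}
    (hb : b ∈ reach (c.lap 0).left) (hr : (c.lap 0).left ∈ reach b) :
    ∃ n, b = (c.lap n).left := by
  obtain ⟨P⟩ := hb
  induction P with
  | nil => exact ⟨0, rfl⟩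
  | @cons b d P e ih =>
    obtain ⟨n, hn⟩ := ih (reach_trans (edge_mem_reach e) hr)
    have he := eq_edge_of_reach hc (f := ⟨b, d, e⟩) hn hr
    exact ⟨n + 1, by rw [← lap_chain, ← he]⟩

end DirCycle

theorem infPath_mem_recurrentSet {o : E} {x : InfPath (CoverTree o)} (hx : x.vert 0 = root o)
    {w : E} (hw : ∀ n, ∃ m, n ≤ m ∧ (x.vert m).terminus = w) :
    pathPoint x hx ∈ recurrentSet w := by
  rintro B ⟨-, n, hn⟩
  obtain ⟨m, hm, hmw⟩ := hw n
  exact ⟨x.vert m, hmw, (x.reach_vert_subset hm).trans hn⟩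

/-- The arrow given by one period of a periodic infinite path fixes its point, and is not an identity
because its degree is positive. -/
theorem not_trivialIsotropy_of_labels {o : E} {x : InfPath (CoverTree o)}
    (hx : x.vert 0 = root o) {k : ℕ} (hk : 0 < k)
    (hper : ∀ i, x.labels (k + i) = x.labels i) : ¬ TrivialIsotropy (pathPoint x hx) := by
  intro h
  have hterm : (x.vert k).terminus = (x.vert 0).terminus :=
    congrArg Quiver.Total.left (hper 0)
  obtain ⟨α, hα⟩ := exists_leftMul_eq hterm
  have hshift : ∀ i, x.vert (k + i) = (x.translate α).vert (0 + i) :=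
    InfPath.vert_congr hα.symm fun i => (hper i).trans (by rw [Nat.zero_add]; rfl)
  have key : ∀ B, B ∈ pathFilter x ↔ leftMul α ⁻¹' B ∈ pathFilter x := fun B => by
    rw [← mem_pathFilter_translate, ← pathFilter_congr hshift]
  have hid : α = 𝟙 _ := h α key
  have hvert : x.vert 0 = x.vert k := by
    rw [← hα, hid]
    simp [leftMul]
  have hd := congrArg deg hvert
  rw [x.deg_vert k] at hd
  omega

/-- Over a vertex of a terminal or transitory cycle, the only point of the recurrent set is the
infinite path around the cycle, which has nontrivial isotropy. -/
theorem not_trivialIsotropy_of_mem_recurrentSet {c : DirCycle E}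
    (hc : c.IsTerminal ∨ c.IsTransitory) {X : UnitSpace E}
    (hX : X ∈ recurrentSet (c.lap 0).left) (hX0 : X.1.1 = (c.lap 0).left) :
    ¬ TrivialIsotropy X := by
  have hreach : ∀ p, reach p ∈ X.1.2.1.sets → (c.lap 0).left ∈ reach p.terminus := by
    intro p hp
    obtain ⟨q, hq, hqp⟩ := hX _ hp
    rw [← hq]
    exact terminus_mem_reach (hqp (mem_reach_self q))
  obtain ⟨p, hp, hs⟩ | ⟨x, hx, hs⟩ := X.2
  · -- A finite path has to end on the cycle at a vertex where just one edge leads back to it.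
    exfalso
    have hpw := hreach p (by rw [hs]; exact ⟨reach_mem_setRing p, mem_reach_self p⟩)
    obtain ⟨n, hn⟩ := DirCycle.exists_lap_of_reach hc
      (by have := terminus_mem_reach hp; rwa [← hX0]) hpw
    obtain ⟨p', e, he⟩ := exists_edge_lift p (c.lap n) hn.symm
    have hmem : reachAvoid p {⟨p', e⟩} ∈ X.1.2.1.sets := by
      rw [hs]
      exact ⟨reachAvoid_mem_setRing _ _, self_mem_reachAvoid _ _⟩
    obtain ⟨q, hq, hqB⟩ := hX _ hmem
    obtain rfl | ⟨⟨p'', f⟩, hf, hqf⟩ := hqB (mem_reach_self q)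
    · obtain h | ⟨f, hf, hz⟩ := hqB (edge_mem_reach e)
      · have hnot : q ∉ reach p' := not_mem_reach_star ⟨p', e⟩
        rw [show p' = q from h] at hnot
        exact hnot (mem_reach_self q)
      · exact hf (Finset.mem_singleton.2 (star_unique hz (mem_reach_self _)))
    · have hfe : edgeTotal f = c.lap n := by
        refine DirCycle.eq_edge_of_reach hc hn ?_
        have h := terminus_mem_reach hqf
        rwa [hq] at h
      exact hf (Finset.mem_singleton.2
        (star_ext (edge_target_unique f e (hfe.trans he.symm))))
  · have hlab : ∀ n, x.labels n = c.lap n := by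
      intro n
      have hback : (c.lap 0).left ∈ reach (x.labels n).right :=
        hreach _ (by rw [hs]; exact reach_mem_pathFilter x (n + 1))
      induction n with
      | zero =>
        refine DirCycle.eq_edge_of_reach hc ?_ hback
        change (x.vert 0).terminus = _
        rw [hx, ← hX0]
        rfl
      | succ n ih =>
        refine DirCycle.eq_edge_of_reach hc ?_ hback
        rw [← c.lap_chain, ← ih]
        · rfl
        · exact hreach _ (by rw [hs]; exact reach_mem_pathFilter x (n + 1))
    rw [eq_pathPoint X x hx hs]
    refine not_trivialIsotropy_of_labels hx (Nat.succ_pos c.len) fun i => ?_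
    rw [hlab, hlab, Nat.add_comm, c.lap_add_period]

/-- A terminal or transitory cycle is isolated in the corresponding recurrent set. -/
theorem not_dense_trivialIsotropy {c : DirCycle E} (hc : c.IsTerminal ∨ c.IsTransitory) :
    ¬ Dense {X : recurrentSet (c.lap 0).left | TrivialIsotropy X.1} := by
  intro hd
  obtain ⟨x, hx, hxl⟩ := exists_lift (root (c.lap 0).left) c.lap c.lap_chain rfl
  have hxK : pathPoint x hx ∈ recurrentSet (c.lap 0).left := by
    refine infPath_mem_recurrentSet hx fun n => ⟨(c.len + 1) * n,
      Nat.le_mul_of_pos_left n (Nat.succ_pos _), ?_⟩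
    change (x.labels _).left = _
    rw [hxl, c.lap_mul_period]
  have hO : IsOpen {y : CoverBoundary E | y.1 = (c.lap 0).left} := by
    rw [isOpen_sigma_iff]
    intro o
    by_cases h : o = (c.lap 0).left <;> simp [h]
  have hO' : IsOpen {X : recurrentSet (c.lap 0).left | X.1.1.1 = (c.lap 0).left} :=
    hO.preimage (continuous_subtype_val.comp continuous_subtype_val)
  obtain ⟨X, hX0, hX⟩ := hd.exists_mem_open hO' ⟨⟨_, hxK⟩, rfl⟩
  exact not_trivialIsotropy_of_mem_recurrentSet hc X.2 hX hX0

end DirGraph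

theorem theorem3p14 (E : Type u) [Quiver.{v} E] :
    @DirGraph.EssentiallyPrincipal (DirGraph.UnitSpace E) _ (DirGraph.graphGroupoid E) ↔
      ¬ ∃ c : DirGraph.DirCycle E, c.IsTerminal ∨ c.IsTransitory := by
  constructor
  · rintro h ⟨c, hc⟩
    exact DirGraph.not_dense_trivialIsotropy hc
      ((DirGraph.essentiallyFree_restriction_iff _).1
        (h _ (DirGraph.isClosed_recurrentSet _) (DirGraph.isInvariant_recurrentSet _)))
  · intro hE K hKc hK
    exact (DirGraph.essentiallyFree_restriction_iff K).2
      (DirGraph.dense_trivialIsotropy hE hKc hK)
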